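/- Let $p$ be an odd prime, let $n=p^p-1$, and let $\alpha$ be a primitive element of $\mathbb F_{p^p}$, i.e. a primitive $n$-th root of unity. Let $\mathbf C_{(p,p^p-1,2p+2,1)}$ be the narrow-sense primitive BCH code of length $n$ and designed distance $2p+2$ over $\mathbb F_p$, i.e. the cyclic code of all words $(c_0,\dots,c_{n-1})\in\mathbb F_p^n$ for which $\sum_{i=0}^{n-1}c_ix^i$ is a multiple of $$g(x)=\operatorname{lcm}\bigl(m_1(x),m_2(x),\dots,m_{2p+1}(x)\bigr),$$ where $m_i(x)$ is the minimal polynomial of $\alpha^i$ over $\mathbb F_p$. Then $\mathbf C_{(p,p^p-1,2p+2,1)}$ has minimum Hamming distance $2p+2$ and dimension $p^p-1-2p^2+p$ over $\mathbb F_p$. Moreover, let $L(x)=x^{2p+1}+x^{2p}+\dots+x^2-x-1\in\mathbb F_p[x]$. The field $\mathbb F_{p^p}$ is a splitting field of $L(x)$ over $\mathbb F_p$, and the word $(c_0,\dots,c_{n-1})$ with $c_i=1$ if $\alpha^i$ is a root of $(x-1)L(x)$ and $c_i=0$ otherwise is a codeword of $\mathbf C_{(p,p^p-1,2p+2,1)}$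 of weight $2p+2$. -/

import Mathlib

open Polynomial

noncomputable section

namespace BCH

/-- The polynomial `c₀ + c₁ x + ⋯ + cₙ₋₁ xⁿ⁻¹` attached to a word `c = (c₀, …, cₙ₋₁)`. -/
def wordPoly {F : Type*} [Field F] {n : ℕ} (c : Fin n → F) : F[X] :=
  ∑ i : Fin n, C (c i) * X ^ (i : ℕ)

/-- The cyclic code of length `n` over `F` with generator polynomial `g` (a divisor of `xⁿ - 1`):
the words whose polynomial is a multiple of `g`. -/
def cyclicCode {F : Type*} [Field F] (n : ℕ) (g : F[X]) : Submodule F (Fin n → F) where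
  carrier := {c | g ∣ wordPoly c}
  zero_mem' := by simp [wordPoly]
  add_mem' := by
    intro a b ha hb
    have h : wordPoly (a + b) = wordPoly a + wordPoly b := by
      simp [wordPoly, add_mul, Finset.sum_add_distrib]
    simp only [Set.mem_setOf_eq] at ha hb ⊢
    rw [h]
    exact dvd_add ha hb
  smul_mem' := by
    intro r a ha
    have h : wordPoly (r • a) = C r * wordPoly a := by
      simp [wordPoly, Finset.mul_sum, mul_assoc]
    simp only [Set.mem_setOf_eq] at ha ⊢
    rw [h]
    exact ha.mul_left _

open Classical in
/-- The generator polynomial `lcm (m_b, m_{b+1}, …, m_{b+δ-2})`, where `m_i` is the minimal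
polynomial of `α ^ i` over `F`. The lcm is the normalized, that is monic, one. -/
def generator (F : Type*) [Field F] {K : Type*} [Field K] [Algebra F K] (α : K) (δ b : ℕ) :
    F[X] :=
  letI : NormalizedGCDMonoid F[X] := UniqueFactorizationMonoid.toNormalizedGCDMonoid F[X]
  (Finset.Ico b (b + δ - 1)).lcm fun i => minpoly F (α ^ i)

/-- The multiples of the generator polynomial are the polynomials over `F` vanishing at
`α ^ b, …, α ^ (b + δ - 2)`. -/
theorem generator_dvd_iff {F : Type*} [Field F] {K : Type*} [Field K] [Algebra F K] (α : K)
    (δ b : ℕ) (f : F[X]) :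
    generator F α δ b ∣ f ↔ ∀ i ∈ Finset.Ico b (b + δ - 1), aeval (α ^ i) f = 0 := by
  classical
  letI : NormalizedGCDMonoid F[X] := UniqueFactorizationMonoid.toNormalizedGCDMonoid F[X]
  unfold generator
  rw [Finset.lcm_dvd_iff]
  exact forall₂_congr fun i _ => minpoly.dvd_iff

/-- The generator polynomial divides `xⁿ - 1` when `α` is an `n`-th root of unity. -/
theorem generator_dvd_X_pow_sub_one {F : Type*} [Field F] {K : Type*} [Field K] [Algebra F K]
    {α : K} {n : ℕ} (hα : α ^ n = 1) (δ b : ℕ) : generator F α δ b ∣ X ^ n - 1 := by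
  rw [generator_dvd_iff]
  intro i _
  rw [map_sub, map_pow, aeval_X, map_one, ← pow_mul, mul_comm, pow_mul, hα, one_pow, sub_self]

/-- The BCH code over `F` of length `n`, designed distance `δ` and offset `b`, built from the
primitive `n`-th root of unity `α` of an extension field. -/
def bchCode (F : Type*) [Field F] {K : Type*} [Field K] [Algebra F K] (n : ℕ) (α : K)
    (δ b : ℕ) : Submodule F (Fin n → F) :=
  cyclicCode n (generator F α δ b)

/-- `d` is the minimum distance of the code `C`: the least Hamming distance between two distinct
codewords (in particular two distinct codewords exist). -/
def IsMinDistance {F : Type*} [Field F] [DecidableEq F] {n : ℕ} (C : Submodule F (Fin n → F))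
    (d : ℕ) : Prop :=
  IsLeast {e : ℕ | ∃ a ∈ C, ∃ b ∈ C, a ≠ b ∧ hammingDist a b = e} d

/-- The polynomial `x^(2p+1) + x^(2p) + ⋯ + x^2 - x - 1` over `𝔽_p`. -/
def locatorPoly (p : ℕ) : (ZMod p)[X] :=
  (∑ k ∈ Finset.Icc 2 (2 * p + 1), X ^ k) - X - 1

open Classical in
/-- The word of length `n` with `i`-th entry `1` if `α ^ i` is a root of `f`, and `0` otherwise. -/
def rootWord {F : Type*} [Field F] {K : Type*} [Field K] [Algebra F K] (n : ℕ) (α : K)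
    (f : F[X]) : Fin n → F :=
  fun i => if aeval (α ^ (i : ℕ)) f = 0 then 1 else 0

end BCH

end

/-! Everything rests on `(x - 1) L(x) = x^(2p+2) - 2x² + 1 =: N(x)`. If `w^p = w + 1` and `x² = 1 +
1/w`, then `N(x) = 0`. Moreover `1 + 1/w = w^(p-1)` is a square. The `p` Artin–Schreier roots `w`
lie in `𝔽_{p^p}`, so with `x = ±1` they give `2(p + 1)` distinct roots of `N`
(`exists_finset_roots`). At a root, `x N'(x) = -2`, so the power sum of exponent `j` is `-2 ∑
x^(j-1) / N'(x)`. By Lagrange interpolation it vanishes for `1 ≤ j ≤ 2p + 1`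
(`sum_roots_pow_eq_zero`). Thus the root word is a codeword of weight `2p + 2`, which the BCH bound
shows to be minimal. For the dimension, the exponents `1, …, 2p + 1` other than `p, 2p` lie in
distinct Frobenius orbits of size `p`, so `deg g = (2p - 1)p` (`natDegree_generator`). -/

namespace BCH

/-! ### Cyclic codes, the BCH bound and root words. -/

section Code

variable {F : Type*} [Field F]

theorem aeval_wordPoly {K : Type*} [Field K] [Algebra F K] {n : ℕ} (c : Fin n → F) (x : K) :
    aeval x (wordPoly c) = ∑ i, algebraMap F K (c i) * x ^ (i : ℕ) := by
  simp [wordPoly]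

/-- A word lies in the BCH code iff its polynomial vanishes at `α ^ b, …, α ^ (b + δ - 2)`. -/
theorem mem_bchCode_iff {K : Type*} [Field K] [Algebra F K] {n : ℕ} {α : K} {δ b : ℕ}
    {c : Fin n → F} :
    c ∈ bchCode F n α δ b ↔
      ∀ j ∈ Finset.Ico b (b + δ - 1), ∑ i, algebraMap F K (c i) * (α ^ (i : ℕ)) ^ j = 0 := by
  have h : c ∈ bchCode F n α δ b ↔ generator F α δ b ∣ wordPoly c := Iff.rfl
  simp_rw [h, generator_dvd_iff, aeval_wordPoly, ← pow_mul, mul_comm]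

/-- Words of length `n` as polynomials, as a linear map. -/
noncomputable def wordPolyHom (F : Type*) [Field F] (n : ℕ) : (Fin n → F) →ₗ[F] F[X] where
  toFun := wordPoly
  map_add' a b := by simp [wordPoly, add_mul, Finset.sum_add_distrib]
  map_smul' r a := by simp [wordPoly, Finset.mul_sum, mul_assoc, smul_eq_C_mul]

theorem wordPoly_coeff {n : ℕ} {f : F[X]} (hf : f.degree < n) :
    wordPoly (fun i : Fin n => f.coeff i) = f := by
  rw [wordPoly, Fin.sum_univ_eq_sum_range (fun i => C (f.coeff i) * X ^ i)]
  rcases eq_or_ne f 0 with rfl | h0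
  · simp
  · exact (f.as_sum_range_C_mul_X_pow' ((natDegree_lt_iff_degree_lt h0).2 hf)).symm

/-- A cyclic code of length `n` with generator polynomial `g` has dimension `n - deg g`. -/
theorem finrank_cyclicCode_add {n : ℕ} {g : F[X]} (hg : g ≠ 0) (hn : g.natDegree ≤ n) :
    Module.finrank F (cyclicCode n g) + g.natDegree = n := by
  -- The code is the kernel of reduction modulo `g`, which is onto because remainders have degree
  -- below `deg g ≤ n`.
  let φ : (Fin n → F) →ₗ[F] AdjoinRoot g := (AdjoinRoot.mkₐ g).toLinearMap ∘ₗ wordPolyHom F n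
  have hker : LinearMap.ker φ = cyclicCode n g := by
    ext c
    exact AdjoinRoot.mk_eq_zero
  have hsurj : Function.Surjective φ := by
    intro x
    obtain ⟨f, rfl⟩ := AdjoinRoot.mk_surjective x
    have hdeg : (f % g).degree < n :=
      (EuclideanDomain.mod_lt f hg).trans_le (degree_le_natDegree.trans (by exact_mod_cast hn))
    refine ⟨fun i => (f % g).coeff i, ?_⟩
    change AdjoinRoot.mk g (wordPoly _) = _
    rw [wordPoly_coeff hdeg, AdjoinRoot.mk_eq_mk]
    exact ⟨-(f / g), by linear_combination EuclideanDomain.div_add_mod f g⟩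
  have h := φ.finrank_range_add_finrank_ker
  rw [hker, LinearMap.range_eq_top.2 hsurj, finrank_top, Module.finrank_fin_fun,
    (AdjoinRoot.powerBasis hg).finrank, AdjoinRoot.powerBasis_dim] at h
  omega

/-- The BCH bound: nonzero words of a BCH code have weight at least the designed distance. -/
theorem le_hammingNorm_of_mem_bchCode [DecidableEq F] {K : Type*} [Field K] [Algebra F K] {n : ℕ}
    {α : K} (hα : IsPrimitiveRoot α n) {δ b : ℕ} {c : Fin n → F}
    (hc : c ∈ bchCode F n α δ b) (h0 : c ≠ 0) : δ ≤ hammingNorm c := by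
  classical
  by_contra! hlt
  rw [mem_bchCode_iff] at hc
  obtain ⟨i₀, hi₀⟩ := Function.ne_iff.1 h0
  have hα0 : α ≠ 0 := hα.ne_zero (by have := i₀.2; omega)
  have hinj : Function.Injective fun i : Fin n => α ^ (i : ℕ) := fun i j h =>
    Fin.ext (hα.pow_inj i.2 j.2 h)
  let S : Finset (Fin n) := {i | c i ≠ 0}
  have hS : S.card < δ := hlt
  have hi₀S : i₀ ∈ S := by simpa [S] using hi₀
  have key : ∀ P : K[X], P.natDegree + 1 < δ →
      ∑ i, algebraMap F K (c i) * (α ^ (i : ℕ)) ^ b * P.eval (α ^ (i : ℕ)) = 0 := by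
    intro P hP
    simp_rw [eval_eq_sum_range, Finset.mul_sum]
    rw [Finset.sum_comm]
    refine Finset.sum_eq_zero fun k hk => ?_
    have hk' := Finset.mem_range.1 hk
    have := hc (b + k) (Finset.mem_Ico.2 ⟨by omega, by omega⟩)
    calc _ = P.coeff k * ∑ i, algebraMap F K (c i) * (α ^ (i : ℕ)) ^ (b + k) := by
          rw [Finset.mul_sum]
          exact Finset.sum_congr rfl fun i _ => by ring
      _ = 0 := by rw [this, mul_zero]
  -- This polynomial vanishes on the support except at `i₀`, so a single nonzero term survives in
  -- `key`.
  have hP := key (∏ i ∈ S.erase i₀, (X - C (α ^ (i : ℕ)))) (by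
    rw [natDegree_finsetProd_X_sub_C_eq_card, Finset.card_erase_of_mem hi₀S]
    have := Finset.card_pos.2 ⟨i₀, hi₀S⟩
    omega)
  rw [Finset.sum_eq_single i₀] at hP
  · rw [eval_prod, mul_eq_zero, mul_eq_zero, Finset.prod_eq_zero_iff] at hP
    rcases hP with (h | h) | ⟨i, hi, h⟩
    · exact hi₀ ((map_eq_zero _).1 h)
    · exact pow_ne_zero _ (pow_ne_zero _ hα0) h
    · rw [eval_sub, eval_X, eval_C, sub_eq_zero] at h
      exact (Finset.mem_erase.1 hi).1 (hinj h.symm)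
  · intro i _ hi
    by_cases hci : c i = 0
    · simp [hci]
    · rw [eval_prod, Finset.prod_eq_zero (i := i) (by simp [S, hi, hci]) (by simp), mul_zero]
  · simp

/-- A BCH code containing a word of weight the designed distance has that minimum distance. -/
theorem isMinDistance_bchCode [DecidableEq F] {K : Type*} [Field K] [Algebra F K] {n : ℕ}
    {α : K} (hα : IsPrimitiveRoot α n) {δ b' : ℕ} (hδ : δ ≠ 0) {c : Fin n → F}
    (hc : c ∈ bchCode F n α δ b') (hw : hammingNorm c = δ) :
    IsMinDistance (bchCode F n α δ b') δ := by
  refine ⟨⟨c, hc, 0, Submodule.zero_mem _, ?_, by rw [hammingDist_zero_right, hw]⟩, ?_⟩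
  · rintro rfl
    exact hδ (by rw [← hw, hammingNorm_zero])
  · rintro _ ⟨a, ha, b, hb, hab, rfl⟩
    rw [hammingDist_eq_hammingNorm]
    have h : -a + b ∈ bchCode F n α δ b' :=
      Submodule.add_mem _ (Submodule.neg_mem _ ha) hb
    exact le_hammingNorm_of_mem_bchCode hα h (neg_add_eq_zero.not.2 hab)

/-- If `α` is a primitive element, summing over the exponents is summing over nonzero elements. -/
theorem sum_rootWord {K : Type*} [Field K] [Algebra F K] [DecidableEq K] {n : ℕ} [NeZero n]
    {α : K} (hα : IsPrimitiveRoot α n) {f : F[X]} {R : Finset K}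
    (hR : ∀ x, x ∈ R ↔ aeval x f = 0) (hpow : ∀ x ∈ R, x ^ n = 1) (h : K → K) :
    ∑ i, algebraMap F K (rootWord n α f i) * h (α ^ (i : ℕ)) = ∑ x ∈ R, h x := by
  classical
  have h1 : ∀ i : Fin n, algebraMap F K (rootWord n α f i) * h (α ^ (i : ℕ)) =
      if α ^ (i : ℕ) ∈ R then h (α ^ (i : ℕ)) else 0 := by
    intro i
    simp only [rootWord, hR]
    split_ifs <;> simp
  simp_rw [h1]
  rw [← Finset.sum_filter]
  refine Finset.sum_bij (fun i _ => α ^ (i : ℕ)) (by simp)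
    (fun i _ j _ h => Fin.ext (hα.pow_inj i.2 j.2 h)) (fun x hx => ?_) (fun _ _ => rfl)
  obtain ⟨i, hi, rfl⟩ := hα.eq_pow_of_pow_eq_one (hpow x hx)
  exact ⟨⟨i, hi⟩, by simpa using hx, rfl⟩

theorem hammingNorm_rootWord [DecidableEq F] {K : Type*} [Field K] [Algebra F K] {n : ℕ} [NeZero n]
    {α : K} (hα : IsPrimitiveRoot α n) {f : F[X]} {R : Finset K}
    (hR : ∀ x, x ∈ R ↔ aeval x f = 0) (hpow : ∀ x ∈ R, x ^ n = 1) :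
    hammingNorm (rootWord n α f) = R.card := by
  classical
  refine Finset.card_bij (fun i _ => α ^ (i : ℕ)) (fun i hi => ?_)
    (fun i _ j _ h => Fin.ext (hα.pow_inj i.2 j.2 h)) (fun x hx => ?_)
  · rw [hR]
    simpa [rootWord] using hi
  · obtain ⟨i, hi, rfl⟩ := hα.eq_pow_of_pow_eq_one (hpow x hx)
    exact ⟨⟨i, hi⟩, by simpa [rootWord, hR] using hx, rfl⟩

end Code

/-! ### Artin–Schreier roots in the field with `p ^ p` elements. -/

section ArtinSchreier

variable {p : ℕ} [hp : Fact p.Prime]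

/-- Iterating Frobenius on `w^p = w + 1` adds `1` each time. At `k = p` the constant vanishes,
leaving a divisor of `X^(p^p) - X`. -/
theorem X_pow_sub_X_sub_one_dvd {K : Type*} [Field K] [CharP K p] (k : ℕ) :
    (X ^ p - X - 1 : K[X]) ∣ X ^ p ^ k - X - (k : K[X]) := by
  induction k with
  | zero => simp
  | succ k ih =>
    have h : (X ^ p ^ (k + 1) - X - ((k + 1 : ℕ) : K[X]) : K[X]) =
        (X ^ p ^ k - X - (k : K[X])) ^ p + (X ^ p - X - 1) := by
      have hk : ((k : K[X])) ^ p = k := by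
        have := map_natCast (frobenius K[X] p) k
        rwa [frobenius_def] at this
      rw [sub_pow_char, sub_pow_char, hk, ← pow_mul, ← pow_succ]
      push_cast
      ring
    rw [h]
    exact dvd_add (dvd_pow ih hp.out.ne_zero) dvd_rfl

theorem natDegree_X_pow_sub_X_sub_one {K : Type*} [Field K] :
    (X ^ p - X - 1 : K[X]).natDegree = p := by
  have := hp.out.two_le
  compute_degree!
  all_goals (try split_ifs) <;> first | omega | simp

/-- The Artin–Schreier polynomial `x ^ p - x - 1` has a root in the field with `p ^ p` elements. -/
theorem exists_pow_eq_add_one {K : Type*} [Field K] [CharP K p] (hK : Nat.card K = p ^ p) :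
    ∃ z : K, z ^ p = z + 1 := by
  have hs : (X ^ p - X - 1 : K[X]).Splits := by
    have h1 := splits_X_pow_nat_card_sub_X (K := K)
    rw [hK] at h1
    have h2 := X_pow_sub_X_sub_one_dvd (p := p) (K := K) p
    rw [CharP.cast_eq_zero K[X] p, sub_zero] at h2
    exact h1.of_dvd
      (FiniteField.X_pow_card_pow_sub_X_ne_zero K hp.out.ne_zero hp.out.one_lt) h2
  obtain ⟨z, hz⟩ := hs.exists_eval_eq_zero (by
    rw [degree_eq_natDegree (ne_zero_of_natDegree_gt
      (by rw [natDegree_X_pow_sub_X_sub_one (p := p)]; exact hp.out.pos)),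
      natDegree_X_pow_sub_X_sub_one]
    exact_mod_cast hp.out.ne_zero)
  refine ⟨z, ?_⟩
  simp only [eval_sub, eval_pow, eval_X, eval_one] at hz
  linear_combination hz

end ArtinSchreier

/-! ### Roots of the locator polynomial, their power sums, and the splitting field. -/

section Locator

variable {p : ℕ} [hp : Fact p.Prime]

theorem X_sub_one_mul_locatorPoly (p : ℕ) :
    (X - 1) * locatorPoly p = X ^ (2 * p + 2) - 2 * X ^ 2 + 1 := by
  have h := geom_sum_Ico_mul (X : (ZMod p)[X]) (m := 2) (n := 2 * p + 2) (by omega)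
  have h2 : Finset.Icc 2 (2 * p + 1) = Finset.Ico 2 (2 * p + 2) := by
    ext; simp; omega
  rw [locatorPoly, h2]
  linear_combination h

theorem monic_X_sub_one_mul_locatorPoly (p : ℕ) [Fact p.Prime] :
    ((X - 1) * locatorPoly p).Monic := by
  rw [X_sub_one_mul_locatorPoly]
  have := (Fact.out : p.Prime).two_le
  monicity!
  all_goals omega

theorem natDegree_X_sub_one_mul_locatorPoly (p : ℕ) [Fact p.Prime] :
    ((X - 1) * locatorPoly p).natDegree = 2 * p + 2 := by
  rw [X_sub_one_mul_locatorPoly]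
  have := (Fact.out : p.Prime).two_le
  compute_degree!
  all_goals (try split_ifs) <;> first | omega | simp

theorem sq_pow_half_mul {K : Type*} [Field K] (h2 : p ≠ 2) {w : K} (hw : w ^ p = w + 1) :
    (w ^ ((p - 1) / 2)) ^ 2 * w = w + 1 := by
  have := (hp.out.even_sub_one h2).two_dvd
  rw [← pow_mul, Nat.div_mul_cancel this, ← pow_succ, Nat.sub_add_cancel hp.out.one_le, hw]

variable {K : Type*} [Field K] [Algebra (ZMod p) K]

theorem aeval_X_sub_one_mul_locatorPoly (x : K) :
    aeval x ((X - 1) * locatorPoly p) = x ^ (2 * p + 2) - 2 * x ^ 2 + 1 := by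
  rw [X_sub_one_mul_locatorPoly]
  simp only [map_add, map_sub, map_mul, map_pow, aeval_X, map_one, map_ofNat]

/-- Elements whose square is `1 + 1 / w`, with `w` an Artin–Schreier root, are roots. -/
theorem aeval_eq_zero_of_sq_mul_eq [CharP K p] {x w : K} (hw : w ^ p = w + 1)
    (hx : x ^ 2 * w = w + 1) :
    aeval x ((X - 1) * locatorPoly p) = 0 := by
  have hw0 : w ≠ 0 := by
    rintro rfl
    simp [hp.out.ne_zero] at hw
  have hw1 : w + 1 ≠ 0 := hw ▸ pow_ne_zero _ hw0
  have h1 : (x ^ 2) ^ p * (w + 1) = w + 2 := by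
    rw [← hw, ← mul_pow, hx, add_pow_char, hw]
    ring
  rw [aeval_X_sub_one_mul_locatorPoly]
  have h2 : (x ^ (2 * p + 2) - 2 * x ^ 2 + 1) * (w * (w + 1)) = 0 := by
    have : x ^ (2 * p + 2) = (x ^ 2) ^ p * x ^ 2 := by ring
    rw [this]
    linear_combination (x ^ 2 * w) * h1 + (w + 2 - 2 * (w + 1)) * hx
  exact (mul_eq_zero.1 h2).resolve_right (mul_ne_zero hw0 hw1)

/-- In the field with `p ^ p` elements, `(x - 1) L(x)` has `2 * p + 2` distinct roots. -/
theorem exists_finset_roots [CharP K p] (h2 : p ≠ 2) (hK : Nat.card K = p ^ p) :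
    ∃ R : Finset K, R.card = 2 * p + 2 ∧ ∀ x ∈ R, aeval x ((X - 1) * locatorPoly p) = 0 := by
  classical
  obtain ⟨z, hz⟩ := exists_pow_eq_add_one hK
  have hz0 : ∀ a : ZMod p, (z + algebraMap _ K a) ^ p = (z + algebraMap _ K a) + 1 := by
    intro a
    rw [add_pow_char, hz, ← map_pow, ZMod.pow_card]
    ring
  have hne : ∀ a : ZMod p, z + algebraMap _ K a ≠ 0 := by
    intro a h
    have := hz0 a
    simp [h, hp.out.ne_zero] at this
  -- `none` carries the root `1`, `some a` a square root of `1 + 1/w` for `w = z + a`; the sign is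
  -- added by `ψ`.
  let y : Option (ZMod p) → K := fun o => o.elim 1 fun a => (z + algebraMap _ K a) ^ ((p - 1) / 2)
  have hy0 : ∀ o, y o ≠ 0 := by
    rintro (_ | a)
    · simp [y]
    · exact pow_ne_zero _ (hne a)
  have hysq : ∀ o o', y o ^ 2 = y o' ^ 2 → o = o' := by
    have hs : ∀ a : ZMod p, y (some a) ^ 2 * (z + algebraMap _ K a) = z + algebraMap _ K a + 1 :=
      fun a => sq_pow_half_mul h2 (hz0 a)
    rintro (_ | a) (_ | b) h
    · rfl
    · have := hs b
      rw [← h] at this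
      simp [y] at this
    · have := hs a
      rw [h] at this
      simp [y] at this
    · have ha := hs a
      have hb := hs b
      rw [h] at ha
      have h3 : (y (some b) ^ 2 - 1) * (algebraMap _ K a - algebraMap _ K b) = 0 := by
        linear_combination ha - hb
      rcases mul_eq_zero.1 h3 with h4 | h4
      · rw [sub_eq_zero.1 h4] at hb
        simp at hb
      · rw [sub_eq_zero] at h4
        rw [(algebraMap (ZMod p) K).injective h4]
  have h20 : (2 : K) ≠ 0 := by
    have : (2 : ℕ) = (2 : K) := by norm_num
    rw [← this, Ne, CharP.cast_eq_zero_iff K p]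
    exact fun h => h2 ((Nat.prime_dvd_prime_iff_eq hp.out Nat.prime_two).1 h)
  let ψ : Option (ZMod p) × Bool → K := fun o => if o.2 then y o.1 else - y o.1
  have hψsq : ∀ o, ψ o ^ 2 = y o.1 ^ 2 := by
    intro o
    simp only [ψ]
    split_ifs <;> ring
  have hψ : Function.Injective ψ := by
    rintro ⟨o, b⟩ ⟨o', b'⟩ h
    obtain rfl : o = o' := hysq _ _ (by rw [← hψsq (o, b), h, hψsq])
    have hyy : y o ≠ - y o := fun h => by
      have : 2 * y o = 0 := by linear_combination h
      exact (mul_ne_zero h20 (hy0 o)) this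
    cases b <;> cases b' <;> simp only [ψ, if_true, if_false, Bool.false_eq_true] at h ⊢
    · exact absurd h.symm hyy
    · exact absurd h hyy
  refine ⟨Finset.univ.image ψ, ?_, ?_⟩
  · rw [Finset.card_image_of_injective _ hψ]
    simp [ZMod.card]
    ring
  · intro x hx
    obtain ⟨⟨o, b⟩, -, rfl⟩ := Finset.mem_image.1 hx
    rcases o with _ | a
    · have h1 : ψ (none, b) ^ 2 = 1 := by rw [hψsq]; simp [y]
      rw [aeval_X_sub_one_mul_locatorPoly, show 2 * p + 2 = 2 * (p + 1) by ring, pow_mul, h1]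
      norm_num
    · refine aeval_eq_zero_of_sq_mul_eq (hz0 a) ?_
      rw [hψsq]
      exact sq_pow_half_mul h2 (hz0 a)

theorem nodal_eq_of_card_eq_natDegree {f : (ZMod p)[X]} (hf : f.Monic) {R : Finset K}
    (hR : R.card = f.natDegree) (h0 : ∀ x ∈ R, aeval x f = 0) :
    Lagrange.nodal R id = f.map (algebraMap (ZMod p) K) := by
  have hm := hf.map (algebraMap (ZMod p) K)
  have hle : R.val ≤ (f.map (algebraMap (ZMod p) K)).roots := by
    rw [Finset.val_le_iff_val_subset]
    intro x hx
    rw [mem_roots hm.ne_zero, IsRoot, eval_map_algebraMap]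
    exact h0 x hx
  have hroots : R.val = (f.map (algebraMap (ZMod p) K)).roots :=
    Multiset.eq_of_le_of_card_le hle
      ((card_roots' _).trans (by rw [hf.natDegree_map, ← hR]; rfl))
  rw [← prod_multiset_X_sub_C_of_monic_of_roots_card_eq hm
    (by rw [← hroots, hf.natDegree_map, ← hR]; rfl), ← hroots]
  rfl

/-- The power sums of the roots of `(x - 1) L(x)` vanish up to the exponent `2 * p + 1`. -/
theorem sum_roots_pow_eq_zero [CharP K p] {R : Finset K}
    (hR : Lagrange.nodal R id = ((X - 1) * locatorPoly p).map (algebraMap (ZMod p) K))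
    (hcard : R.card = 2 * p + 2) {j : ℕ} (hj1 : 1 ≤ j) (hj : j ≤ 2 * p + 1) :
    ∑ x ∈ R, x ^ j = 0 := by
  classical
  -- The coefficient of `X^(2p+1)` in `X^(j-1)` is zero because `j - 1 ≤ 2p`.
  have h := Lagrange.coeff_eq_sum (s := R) (v := id) Function.injective_id.injOn
    (P := (X ^ (j - 1) : K[X])) (by
      rw [degree_X_pow, hcard]
      exact_mod_cast (by omega))
  rw [coeff_X_pow, if_neg (by omega)] at h
  have hx : ∀ x ∈ R, x ^ j = -2 *
      ((X ^ (j - 1) : K[X]).eval (id x) / ∏ y ∈ R.erase x, (id x - id y)) := by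
    intro x hx
    have hroot : x ^ (2 * p + 2) - 2 * x ^ 2 + 1 = 0 := by
      rw [← aeval_X_sub_one_mul_locatorPoly (p := p), ← eval_map_algebraMap, ← hR]
      exact Lagrange.eval_nodal_at_node (v := id) hx
    have hd := Lagrange.eval_nodal_derivative_eval_node_eq (v := id) hx
    rw [Lagrange.eval_nodal, hR, X_sub_one_mul_locatorPoly] at hd
    have hd' : ∏ y ∈ R.erase x, (id x - id y) = 2 * x ^ (2 * p + 1) - 4 * x := by
      rw [← hd]
      simp
      ring
    have hmul : x * ∏ y ∈ R.erase x, (id x - id y) = -2 := by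
      rw [hd']
      linear_combination 2 * hroot
    have hne : ∏ y ∈ R.erase x, (id x - id y) ≠ 0 := by
      rw [Finset.prod_ne_zero_iff]
      intro y hy
      exact sub_ne_zero.2 (Finset.ne_of_mem_erase hy).symm
    rw [← mul_div_assoc, eq_div_iff hne, ← hmul, eval_pow, eval_X, id]
    obtain ⟨i, rfl⟩ := Nat.exists_eq_add_of_le' hj1
    simp only [Nat.add_sub_cancel, id]
    ring
  rw [Finset.sum_congr rfl hx, ← Finset.mul_sum, ← h, mul_zero]

theorem finrank_eq_of_card (hK : Nat.card K = p ^ p) :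
    Module.finrank (ZMod p) K = p := by
  have : Finite K := Nat.finite_of_card_ne_zero (hK ▸ pow_ne_zero _ hp.out.ne_zero)
  exact Nat.pow_right_injective hp.out.two_le ((FiniteField.pow_finrank_eq_natCard p K).trans hK)

/-- The field with `p ^ p` elements is a splitting field of the locator polynomial. -/
theorem isSplittingField_locatorPoly [CharP K p] (h2 : p ≠ 2) (hK : Nat.card K = p ^ p)
    {R : Finset K}
    (hR : Lagrange.nodal R id = ((X - 1) * locatorPoly p).map (algebraMap (ZMod p) K)) :
    IsSplittingField (ZMod p) K (locatorPoly p) := by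
  have hL0 : (locatorPoly p) ≠ 0 :=
    right_ne_zero_of_mul (monic_X_sub_one_mul_locatorPoly p).ne_zero
  refine ⟨?_, ?_⟩
  · have hs : (((X - 1) * locatorPoly p).map (algebraMap (ZMod p) K)).Splits := by
      rw [← hR]
      exact Splits.prod fun x _ => Splits.X_sub_C _
    exact hs.of_dvd ((monic_X_sub_one_mul_locatorPoly p).map _).ne_zero
      (Polynomial.map_dvd _ (dvd_mul_left _ _))
  · have hprime : (Module.finrank (ZMod p) K).Prime := by
      rw [finrank_eq_of_card hK]
      exact hp.out
    -- Prime degree leaves no intermediate field. If `x` were in `𝔽_p`, Frobenius applied to `x² z =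
    -- z + 1` would give `x² (z + 1) = z + 2`, hence `x² = 1`, which is absurd.
    refine ((Subalgebra.isSimpleOrder_of_finrank_prime _ _ hprime).eq_bot_or_eq_top
      _).resolve_left fun hbot => ?_
    obtain ⟨z, hz⟩ := exists_pow_eq_add_one hK
    have hsq := sq_pow_half_mul h2 hz
    set x := z ^ ((p - 1) / 2)
    have hx1 : x ≠ 1 := by
      intro h
      simp [h] at hsq
    have hx : aeval x (locatorPoly p) = 0 := by
      have := aeval_eq_zero_of_sq_mul_eq hz hsq
      rw [map_mul, mul_eq_zero] at this
      refine this.resolve_left ?_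
      simpa [sub_eq_zero] using hx1
    have hmem : x ∈ Algebra.adjoin (ZMod p) ((locatorPoly p).rootSet K : Set K) :=
      Algebra.subset_adjoin ((mem_rootSet).2 ⟨hL0, hx⟩)
    rw [hbot, Algebra.mem_bot] at hmem
    obtain ⟨a, ha⟩ := hmem
    have hxp : x ^ p = x := by rw [← ha, ← map_pow, ZMod.pow_card]
    have h3 : x ^ 2 * (z + 1) = z + 1 + 1 := by
      have h4 := congrArg (· ^ p) hsq
      rwa [mul_pow, ← pow_mul, mul_comm 2 p, pow_mul, hxp, add_pow_char, hz, one_pow] at h4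
    have h5 : x ^ 2 = 1 := by linear_combination h3 - hsq
    rw [h5] at hsq
    simp at hsq

end Locator

/-! ### Cyclotomic cosets and the degree of the generator. -/

section Dimension

variable {p : ℕ} [hp : Fact p.Prime]

theorem mul_pow_prime_sub_two_lt (h2 : p ≠ 2) : (2 * p + 1) * p ^ (p - 2) + 1 < p ^ p := by
  have h3 : 3 ≤ p := by have := hp.out.two_le; omega
  obtain ⟨k, rfl⟩ := Nat.exists_eq_add_of_le' h3
  have h1 : (k + 3) ^ 1 ≤ (k + 3) ^ (k + 3 - 2) := Nat.pow_le_pow_right (by omega) (by omega)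
  have h4 : (k + 3) ^ (k + 3) = (k + 3) ^ (k + 3 - 2) * (k + 3) ^ 2 := by
    rw [← pow_add]
    congr 1
  rw [h4]
  generalize (k + 3) ^ (k + 3 - 2) = q at h1 ⊢
  rw [pow_one] at h1
  have h5 : q * (k + 3) ^ 2 = (2 * (k + 3) + 1) * q + q * (k ^ 2 + 4 * k + 2) := by ring
  have h6 : q * 2 ≤ q * (k ^ 2 + 4 * k + 2) := Nat.mul_le_mul_left q (by omega)
  rw [h5]
  omega

/-- Ensures that these exponents do not wrap around modulo `p^p - 1`, so powers of `α` can be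
compared through their exponents. -/
theorem mul_pow_lt {i j : ℕ} (h2 : p ≠ 2) (hi : i ≤ 2 * p + 1) (hj : j ≤ p - 2) :
    i * p ^ j < p ^ p - 1 := by
  have h1 : i * p ^ j ≤ (2 * p + 1) * p ^ (p - 2) :=
    Nat.mul_le_mul hi (Nat.pow_le_pow_right hp.out.pos hj)
  have := mul_pow_prime_sub_two_lt (p := p) h2
  omega

/-- Exponents prime to `p` in `[1, 2 * p + 1]` lie in distinct cyclotomic cosets. -/
theorem eq_of_pow_eq_pow_mul_pow {K : Type*} [Field K] (h2 : p ≠ 2) {α : K}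
    (hα : IsPrimitiveRoot α (p ^ p - 1)) {i i' : ℕ} (hi : i ≤ 2 * p + 1) (hi' : i' ≤ 2 * p + 1)
    (hpi : ¬ p ∣ i) (hpi' : ¬ p ∣ i') {j : ℕ} (hj : j < p) (h : α ^ i' = α ^ (i * p ^ j)) :
    i' = i := by
  have h3 : 3 ≤ p := by have := hp.out.two_le; omega
  have hlt : ∀ {i j : ℕ}, i ≤ 2 * p + 1 → j ≤ p - 2 → i * p ^ j < p ^ p - 1 := mul_pow_lt h2
  have hpp : α ^ p ^ p = α := by
    conv_lhs => rw [← Nat.sub_add_cancel (Nat.one_le_pow p p hp.out.pos)]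
    rw [pow_succ, hα.pow_eq_one, one_mul]
  have hi'n : i' < p ^ p - 1 := by simpa using hlt hi' (Nat.zero_le _)
  have hin : i < p ^ p - 1 := by simpa using hlt hi (Nat.zero_le _)
  rcases Nat.lt_or_ge (p - 2) j with hj2 | hj2
  · obtain rfl : j = p - 1 := by omega
    have h4 : α ^ (i' * p ^ 1) = α ^ i := by
      rw [pow_one, pow_mul, h, ← pow_mul, mul_assoc, ← pow_succ, Nat.sub_add_cancel (by omega),
        mul_comm, pow_mul, hpp]
    have h5 := hα.pow_inj (hlt hi' (by omega)) hin h4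
    exact absurd ⟨i', by rw [← h5, pow_one, mul_comm]⟩ hpi
  · have h5 := hα.pow_inj hi'n (hlt hi hj2) h
    rcases Nat.eq_zero_or_pos j with rfl | hj0
    · simpa using h5
    · exact absurd (h5 ▸ dvd_mul_of_dvd_right (dvd_pow_self p hj0.ne') i) hpi'

variable {K : Type*} [Field K] [Algebra (ZMod p) K]

/-- Conjugates differ by an automorphism, and Frobenius generates the Galois group. -/
theorem exists_eq_pow_of_minpoly_eq [Finite K] {x y : K}
    (h : minpoly (ZMod p) x = minpoly (ZMod p) y) :
    ∃ j < Module.finrank (ZMod p) K, y = x ^ p ^ j := by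
  obtain ⟨σ, rfl⟩ := (isConjRoot_iff_exists_algEquiv (K := ZMod p)).1 h.symm
  obtain ⟨⟨j, hj⟩, rfl⟩ := (FiniteField.bijective_frobeniusAlgEquivOfAlgebraic_pow (ZMod p) K).2 σ
  refine ⟨j, hj, ?_⟩
  rw [AlgEquiv.coe_pow, FiniteField.coe_frobeniusAlgEquivOfAlgebraic_iterate, ZMod.card]

theorem aeval_pow_minpoly (x : K) :
    aeval (x ^ p) (minpoly (ZMod p) x) = 0 := by
  have := aeval_algHom_apply (FiniteField.frobeniusAlgHom (ZMod p) K) x (minpoly (ZMod p) x)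
  rwa [minpoly.aeval, map_zero, FiniteField.coe_frobeniusAlgHom, ZMod.card] at this

/-- The exponents prime to `p` in `[1, 2 * p + 1]`. -/
def cosetLeaders (p : ℕ) : Finset ℕ := Finset.Icc 1 (2 * p + 1) \ {p, 2 * p}

theorem mem_cosetLeaders {i : ℕ} (h2 : p ≠ 2) :
    i ∈ cosetLeaders p ↔ (1 ≤ i ∧ i ≤ 2 * p + 1) ∧ ¬ p ∣ i := by
  have h3 : 3 ≤ p := by have := hp.out.two_le; omega
  rw [cosetLeaders, Finset.mem_sdiff, Finset.mem_Icc]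
  refine and_congr_right fun hi => not_congr ?_
  simp only [Finset.mem_insert, Finset.mem_singleton]
  constructor
  · rintro (rfl | rfl)
    exacts [dvd_rfl, dvd_mul_left _ _]
  · rintro ⟨k, rfl⟩
    have hk : k < 3 := by by_contra! hk; nlinarith
    interval_cases k
    · omega
    · simp
    · right; ring

theorem card_cosetLeaders : (cosetLeaders p).card = 2 * p - 1 := by
  have h2 := hp.out.two_le
  rw [cosetLeaders, Finset.card_sdiff_of_subset, Nat.card_Icc, Finset.card_pair (by omega)]
  · omega
  · intro i
    simp only [Finset.mem_insert, Finset.mem_singleton, Finset.mem_Icc]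
    omega

theorem natDegree_minpoly_pow [Finite K] (h2 : p ≠ 2) (hK : Module.finrank (ZMod p) K = p) {α : K}
    (hα : IsPrimitiveRoot α (p ^ p - 1)) {i : ℕ} (hi : i ≤ 2 * p + 1) (hi0 : 1 ≤ i) :
    (minpoly (ZMod p) (α ^ i)).natDegree = p := by
  have h3 : 3 ≤ p := by have := hp.out.two_le; omega
  have hint : IsIntegral (ZMod p) (α ^ i) := Algebra.IsIntegral.isIntegral _
  have hdvd := minpoly.degree_dvd hint
  rw [hK] at hdvd
  -- Degree one would put `α^i` in `𝔽_p`, forcing `i * p = i`.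
  refine ((Nat.dvd_prime hp.out).1 hdvd).resolve_left fun h1 => ?_
  obtain ⟨a, ha⟩ := minpoly.natDegree_eq_one_iff.1 h1
  have h4 : (α ^ i) ^ p = α ^ i := by rw [← ha, ← map_pow, ZMod.pow_card]
  rw [← pow_mul, ← pow_one p] at h4
  have h5 := hα.pow_inj (by simpa using mul_pow_lt h2 hi (j := 1) (by omega))
    (by simpa using mul_pow_lt h2 hi (j := 0) (by omega)) h4
  rw [pow_one] at h5
  nlinarith

/-- The generator polynomial of the code has degree `(2 * p - 1) * p`. -/
theorem natDegree_generator [Finite K] (h2 : p ≠ 2) (hK : Module.finrank (ZMod p) K = p) {α : K}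
    (hα : IsPrimitiveRoot α (p ^ p - 1)) :
    generator (ZMod p) α (2 * p + 2) 1 ≠ 0 ∧
    (generator (ZMod p) α (2 * p + 2) 1).natDegree = (2 * p - 1) * p := by
  have h3 : 3 ≤ p := by have := hp.out.two_le; omega
  have hint : ∀ x : K, IsIntegral (ZMod p) x := fun x => Algebra.IsIntegral.isIntegral x
  have hmem : ∀ {i}, i ∈ Finset.Ico 1 (1 + (2 * p + 2) - 1) ↔ 1 ≤ i ∧ i ≤ 2 * p + 1 := by
    intro i
    rw [Finset.mem_Ico]
    omega
  have hL := fun {i} => mem_cosetLeaders (p := p) (i := i) h2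
  set P := ∏ i ∈ cosetLeaders p, minpoly (ZMod p) (α ^ i)
  have hP0 : P ≠ 0 := Finset.prod_ne_zero_iff.2 fun i _ => minpoly.ne_zero (hint _)
  have hgP : generator (ZMod p) α (2 * p + 2) 1 ∣ P := by
    rw [generator_dvd_iff]
    intro i hi
    rw [hmem] at hi
    by_cases hpi : p ∣ i
    · obtain ⟨k, rfl⟩ := hpi
      have hk : k < 3 := by by_contra! hk; nlinarith
      have hk0 : 0 < k := Nat.pos_of_ne_zero (by rintro rfl; omega)
      -- The exponents `p` and `2p` add no factor: `α^(kp)` is conjugate to `α^k`.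
      rw [mul_comm p k, pow_mul]
      refine aeval_eq_zero_of_dvd_aeval_eq_zero (Finset.dvd_prod_of_mem _ (hL.2 ⟨?_, ?_⟩))
        (aeval_pow_minpoly (α ^ k))
      · omega
      · exact fun h => by have := Nat.le_of_dvd hk0 h; omega
    · exact aeval_eq_zero_of_dvd_aeval_eq_zero (Finset.dvd_prod_of_mem _ (hL.2 ⟨hi, hpi⟩))
        (minpoly.aeval _ _)
  have hg0 := ne_zero_of_dvd_ne_zero hP0 hgP
  have hPg : P ∣ generator (ZMod p) α (2 * p + 2) 1 := by
    refine Finset.prod_dvd_of_coprime (fun i hi i' hi' hne => ?_) fun i hi => ?_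
    · have hi := hL.1 hi
      have hi' := hL.1 hi'
      refine (minpoly.irreducible (hint _)).coprime_iff_not_dvd.2 fun hdvd => hne ?_
      have heq : minpoly (ZMod p) (α ^ i) = minpoly (ZMod p) (α ^ i') :=
        eq_of_monic_of_associated (minpoly.monic (hint _)) (minpoly.monic (hint _))
          ((minpoly.irreducible (hint _)).associated_of_dvd (minpoly.irreducible (hint _)) hdvd)
      obtain ⟨j, hj, h⟩ := exists_eq_pow_of_minpoly_eq heq
      rw [hK] at hj
      rw [← pow_mul] at h
      exact (eq_of_pow_eq_pow_mul_pow h2 hα hi.1.2 hi'.1.2 hi.2 hi'.2 hj h).symm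
    · exact minpoly.dvd _ _ ((generator_dvd_iff α _ _ _).1 dvd_rfl i (hmem.2 (hL.1 hi).1))
  have hPdeg : P.natDegree = (2 * p - 1) * p := by
    rw [natDegree_prod _ _ fun i _ => minpoly.ne_zero (hint _),
      Finset.sum_congr rfl fun i hi => natDegree_minpoly_pow h2 hK hα (hL.1 hi).1.2 (hL.1 hi).1.1,
      Finset.sum_const, card_cosetLeaders, smul_eq_mul]
  exact ⟨hg0, hPdeg ▸ le_antisymm (natDegree_le_of_dvd hgP hP0) (natDegree_le_of_dvd hPg hg0)⟩

end Dimension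

end BCH

theorem theorem5p4 (p : ℕ) [Fact p.Prime] (hp : p ≠ 2)
    (K : Type*) [Field K] [Algebra (ZMod p) K] (hK : Nat.card K = p ^ p)
    (α : K) (hα : IsPrimitiveRoot α (p ^ p - 1)) :
    BCH.IsMinDistance (BCH.bchCode (ZMod p) (p ^ p - 1) α (2 * p + 2) 1) (2 * p + 2) ∧
    (Module.finrank (ZMod p) (BCH.bchCode (ZMod p) (p ^ p - 1) α (2 * p + 2) 1) : ℤ) =
      (p : ℤ) ^ p - 1 - 2 * (p : ℤ) ^ 2 + p ∧
    Polynomial.IsSplittingField (ZMod p) K (BCH.locatorPoly p) ∧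
    BCH.rootWord (p ^ p - 1) α ((Polynomial.X - 1) * BCH.locatorPoly p) ∈
      BCH.bchCode (ZMod p) (p ^ p - 1) α (2 * p + 2) 1 ∧
    hammingNorm (BCH.rootWord (p ^ p - 1) α ((Polynomial.X - 1) * BCH.locatorPoly p)) =
      2 * p + 2 := by
  classical
  have hpp : p.Prime := Fact.out
  have h3 : 3 ≤ p := by have := hpp.two_le; omega
  have : Finite K := Nat.finite_of_card_ne_zero (hK ▸ pow_ne_zero _ hpp.ne_zero)
  have : CharP K p := charP_of_injective_algebraMap (algebraMap (ZMod p) K).injective p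
  have hlt := BCH.mul_pow_lt (p := p) (i := 2 * p + 1) (j := 1) hp le_rfl (by omega)
  rw [pow_one] at hlt
  have : NeZero (p ^ p - 1) := ⟨by omega⟩
  obtain ⟨R, hcard, hroot⟩ := BCH.exists_finset_roots (K := K) hp hK
  have hnodal := BCH.nodal_eq_of_card_eq_natDegree (BCH.monic_X_sub_one_mul_locatorPoly p)
    (by rw [hcard, BCH.natDegree_X_sub_one_mul_locatorPoly]) hroot
  have hR : ∀ x, x ∈ R ↔ aeval x ((X - 1) * BCH.locatorPoly p) = 0 := by
    refine fun x => ⟨hroot x, fun hx => ?_⟩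
    rw [← eval_map_algebraMap, ← hnodal, Lagrange.eval_nodal, Finset.prod_eq_zero_iff] at hx
    obtain ⟨y, hy, hxy⟩ := hx
    rwa [sub_eq_zero.1 hxy]
  -- The constant term `1` of `N` keeps roots nonzero, so each is a power of `α` and marks a
  -- position of the word.
  have hpow : ∀ x ∈ R, x ^ (p ^ p - 1) = 1 := by
    intro x hx
    have hx0 : x ≠ 0 := by
      rintro rfl
      have := hroot 0 hx
      rw [BCH.aeval_X_sub_one_mul_locatorPoly] at this
      simp at this
    have := Fintype.ofFinite K
    rw [← hK, Nat.card_eq_fintype_card]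
    exact FiniteField.pow_card_sub_one_eq_one x hx0
  have hmem : BCH.rootWord (p ^ p - 1) α ((X - 1) * BCH.locatorPoly p) ∈
      BCH.bchCode (ZMod p) (p ^ p - 1) α (2 * p + 2) 1 := by
    rw [BCH.mem_bchCode_iff]
    intro j hj
    rw [Finset.mem_Ico] at hj
    rw [BCH.sum_rootWord hα hR hpow (· ^ j)]
    exact BCH.sum_roots_pow_eq_zero hnodal hcard hj.1 (by omega)
  have hweight : hammingNorm (BCH.rootWord (F := ZMod p) (p ^ p - 1) α
      ((X - 1) * BCH.locatorPoly p)) = 2 * p + 2 :=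
    (BCH.hammingNorm_rootWord hα hR hpow).trans hcard
  refine ⟨BCH.isMinDistance_bchCode hα (by omega) hmem hweight, ?_,
    BCH.isSplittingField_locatorPoly hp hK hnodal, hmem, hweight⟩
  obtain ⟨hg0, hgdeg⟩ := BCH.natDegree_generator hp (BCH.finrank_eq_of_card hK) hα
  have hle : (2 * p - 1) * p ≤ p ^ p - 1 :=
    (Nat.mul_le_mul_right p (by omega)).trans hlt.le
  have hdim : Module.finrank (ZMod p) (BCH.bchCode (ZMod p) (p ^ p - 1) α (2 * p + 2) 1) +
      (BCH.generator (ZMod p) α (2 * p + 2) 1).natDegree = p ^ p - 1 :=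
    BCH.finrank_cyclicCode_add hg0 (hgdeg ▸ hle)
  rw [hgdeg] at hdim
  zify [Nat.one_le_pow p p hpp.pos, show 1 ≤ 2 * p by omega] at hdim
  linear_combination hdim
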